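/- For $f\in L^1(\mathbb R)$ put $\hat f(\xi)=\int_{\mathbb R} f(x)e^{-2\pi i x\xi}\,dx$, and let $\mathcal P(\mathbb R)$ be the set of Schwartz functions $f:\mathbb R\to\mathbb C$ such that $\hat f$ has compact support. For $1\le p_1,p_2\le\infty$ and $0<p_3\le\infty$ let $\tilde{\mathcal M}_{(p_1,p_2,p_3)}(\mathbb R)$ be the class of measurable functions $M:\mathbb R\to\mathbb C$ such that $(\xi,\eta)\mapsto M(\xi-\eta)$ is locally integrable on $\mathbb R^2$ and the bilinear operator $$B_M(f,g)(x)=\int_{\mathbb R^2}\hat f(\xi)\,\hat g(\eta)\,M(\xi-\eta)\,e^{2\pi i(\xi+\eta)x}\,d\xi\,d\eta,\qquad f,g\in\mathcal P(\mathbb R),$$ satisfies $\|B_M(f,g)\|_{p_3}\le A\,\|f\|_{p_1}\|g\|_{p_2}$ for all $f,g\in\mathcal P(\mathbb R)$ with some finite constant $A$; let $\|M\|_{p_1,p_2,p_3}$ be the infimum of all such $A$. **Theorem.** Let $1\le p_1,p_2,p_3\le\infty$ satisfy $$\frac1{p_3}\le\frac1{p_1}+\frac1{p_2}\le\min\Big\{2,\frac1{p_3}+1\Big\},$$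 and let $1\le q\le\infty$ be defined by $\frac1{p_1}+\frac1{p_2}-\frac1{p_3}=1-\frac1q$. Then there is a constant $C<\infty$, depending only on $p_1,p_2,p_3$, such that the following holds: if $M\in L^1(\mathbb R)$ and $M=\hat K$ (in the sense of tempered distributions) for some $K\in L^q(\mathbb R)$, then $$M\in\tilde{\mathcal M}_{(p_1,p_2,p_3)}(\mathbb R)\qquad\text{and}\qquad \|M\|_{p_1,p_2,p_3}\le C\,\|K\|_q .$$ -/

import Mathlib

open MeasureTheory
open scoped ENNReal NNReal FourierTransform SchwartzMap

noncomputable section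

/-- The class `𝒫(ℝ)` of Schwartz functions whose Fourier transform
`f̂(ξ) = ∫ f(x) e^{-2πixξ} dx` has compact support. -/
def BandLimited : Set 𝓢(ℝ, ℂ) :=
  {f | HasCompactSupport (𝓕 (f : ℝ → ℂ))}

/-- `B_m(f,g)(x) = ∬ f̂(ξ) ĝ(η) m(ξ,η) e^{2πi(ξ+η)x} dξ dη`. -/
def bilinearOp (m : ℝ × ℝ → ℂ) (f g : 𝓢(ℝ, ℂ)) (x : ℝ) : ℂ :=
  ∫ z : ℝ × ℝ, 𝓕 (f : ℝ → ℂ) z.1 * 𝓕 (g : ℝ → ℂ) z.2 * m z *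
    Complex.exp (2 * Real.pi * Complex.I * (z.1 + z.2) * x)

/-- `C` is an admissible constant: `‖B_m(f,g)‖_{p₃} ≤ C ‖f‖_{p₁} ‖g‖_{p₂}` for `f, g ∈ 𝒫(ℝ)`. -/
def BilinearBound (m : ℝ × ℝ → ℂ) (p₁ p₂ p₃ C : ℝ≥0∞) : Prop :=
  ∀ f ∈ BandLimited, ∀ g ∈ BandLimited,
    eLpNorm (bilinearOp m f g) p₃ volume ≤
      C * eLpNorm (f : ℝ → ℂ) p₁ volume * eLpNorm (g : ℝ → ℂ) p₂ volume

/-- The bilinear multipliers of type `(p₁, p₂, p₃)`: locally integrable symbols for which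
`B_m` satisfies the above bound with a finite constant. -/
def BilinearMultipliers (p₁ p₂ p₃ : ℝ≥0∞) : Set (ℝ × ℝ → ℂ) :=
  {m | LocallyIntegrable m volume ∧ ∃ C : ℝ≥0, BilinearBound m p₁ p₂ p₃ C}

/-- `‖m‖_{p₁,p₂,p₃} = ‖B_m‖`, the least admissible constant. -/
def bilinearMultiplierNorm (m : ℝ × ℝ → ℂ) (p₁ p₂ p₃ : ℝ≥0∞) : ℝ≥0∞ :=
  sInf {C | BilinearBound m p₁ p₂ p₃ C}

/-- The symbol `m(ξ,η) = M(ξ-η)`. -/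
def diffSymbol (M : ℝ → ℂ) : ℝ × ℝ → ℂ := fun z => M (z.1 - z.2)

/-- The class of (Lebesgue) measurable `M : ℝ → ℂ` such that `M(ξ-η)` is a bilinear multiplier
of type `(p₁, p₂, p₃)`. -/
def OneVariableMultipliers (p₁ p₂ p₃ : ℝ≥0∞) : Set (ℝ → ℂ) :=
  {M | AEStronglyMeasurable M volume ∧ diffSymbol M ∈ BilinearMultipliers p₁ p₂ p₃}

end

/-! The substitution ζ = ξ - η and Fourier inversion turn the operator into B(f,g)(x) = ∫ K(t)
f(x-t) g(x+t) dt (`bilinearOp_diffSymbol_eq_kernel`). By duality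
(`eLpNorm_le_of_forall_lintegral_mul_le`) it suffices to bound ∬ |K(t) f(x-t) g(x+t)| h(x) dx dt
with h in the dual of `L^{p₃}`; the four reciprocal exponents then sum to 2. Any two of the forms t,
x-t, x+t, x are linearly independent, so a change of variables gives an L¹ × L¹ bound for each pair,
with constant at most 1. Hölder interpolates these six bounds (`lintegral_quadrilinear_le`), because
the exponent vector is a convex combination of indicators of pairs (`exists_pair_weights`). -/

/-- Every point of `[0,1]⁴` with coordinate sum `2` is a nonnegative combination of the indicator
vectors of pairs. -/
theorem exists_pair_weights {a b c d : ℝ} (ha : 0 ≤ a) (hb : 0 ≤ b) (hc : 0 ≤ c) (hd : 0 ≤ d)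
    (ha' : a ≤ 1) (hb' : b ≤ 1) (hc' : c ≤ 1) (hd' : d ≤ 1) (hsum : a + b + c + d = 2) :
    ∃ ab ac ad bc bd cd : ℝ, (0 ≤ ab ∧ 0 ≤ ac ∧ 0 ≤ ad ∧ 0 ≤ bc ∧ 0 ≤ bd ∧ 0 ≤ cd) ∧
      ab + ac + ad = a ∧ ab + bc + bd = b ∧ ac + bc + cd = c ∧ ad + bd + cd = d := by
  wlog hab : b ≤ a generalizing a b
  · obtain ⟨ab, ac, ad, bc, bd, cd, h⟩ := @this b a hb ha hb' ha' (by linarith) (by linarith)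
    exact ⟨ab, bc, bd, ac, ad, cd, by grind⟩
  wlog hcd : d ≤ c generalizing c d
  · obtain ⟨ab, ac, ad, bc, bd, cd, h⟩ := @this d c hd hc hd' hc' (by linarith) (by linarith)
    exact ⟨ab, ad, ac, bd, bc, cd, by grind⟩
  wlog hdb : d ≤ b generalizing a b c d
  · obtain ⟨ab, ac, ad, bc, bd, cd, h⟩ := @this c d hc hd hc' hd' hcd a b ha hb ha' hb'
      (by linarith) hab (by linarith)
    exact ⟨cd, ac, bc, ad, bd, ab, by grind⟩
  -- Now `d` is least; it is paired entirely with the larger of `a` and `c`. The three remaining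
  -- weights solve a triangular system of pair sums; one is nonnegative because the largest
  -- coordinate is at most 1, half the total.
  rcases le_total c a with hca | hca
  · refine ⟨(a - d + b - c) / 2, (a - d + c - b) / 2, d, (b + c - a + d) / 2, 0, 0, ?_⟩
    refine ⟨⟨?_, ?_, ?_, ?_, ?_, ?_⟩, ?_, ?_, ?_, ?_⟩ <;> linarith
  · refine ⟨(a + b - c + d) / 2, (a + c - d - b) / 2, 0, (b + c - d - a) / 2, 0, d, ?_⟩
    refine ⟨⟨?_, ?_, ?_, ?_, ?_, ?_⟩, ?_, ?_, ?_, ?_⟩ <;> linarith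

/-- Interpolation of pairwise `L¹` bounds: if all products of two of the four functions satisfy
`∫ u v ≤ A B`, then `∫ u^a v^b w^c y^d ≤ A^a B^b C^c D^d` for exponents in `[0,1]` with sum `2`. -/
theorem lintegral_rpow_mul_four_le {α : Type*} [MeasurableSpace α] {μ : Measure α}
    {u v w y : α → ℝ≥0∞} (hu : AEMeasurable u μ) (hv : AEMeasurable v μ) (hw : AEMeasurable w μ)
    (hy : AEMeasurable y μ) {A B C D : ℝ≥0∞}
    (huv : ∫⁻ z, u z * v z ∂μ ≤ A * B) (huw : ∫⁻ z, u z * w z ∂μ ≤ A * C)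
    (huy : ∫⁻ z, u z * y z ∂μ ≤ A * D) (hvw : ∫⁻ z, v z * w z ∂μ ≤ B * C)
    (hvy : ∫⁻ z, v z * y z ∂μ ≤ B * D) (hwy : ∫⁻ z, w z * y z ∂μ ≤ C * D)
    {a b c d : ℝ} (ha : 0 ≤ a) (hb : 0 ≤ b) (hc : 0 ≤ c) (hd : 0 ≤ d)
    (ha' : a ≤ 1) (hb' : b ≤ 1) (hc' : c ≤ 1) (hd' : d ≤ 1) (hsum : a + b + c + d = 2) :
    ∫⁻ z, u z ^ a * v z ^ b * w z ^ c * y z ^ d ∂μ ≤ A ^ a * B ^ b * C ^ c * D ^ d := by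
  obtain ⟨ab, ac, ad, bc, bd, cd, ⟨h₁, h₂, h₃, h₄, h₅, h₆⟩, rfl, rfl, rfl, rfl⟩ :=
    exists_pair_weights ha hb hc hd ha' hb' hc' hd' hsum
  have split (r s t x : ℝ≥0∞) :
      r ^ (ab + ac + ad) * s ^ (ab + bc + bd) * t ^ (ac + bc + cd) * x ^ (ad + bd + cd) =
      (r * s) ^ ab * (r * t) ^ ac * (r * x) ^ ad * (s * t) ^ bc * (s * x) ^ bd * (t * x) ^ cd := by
    simp only [ENNReal.mul_rpow_of_nonneg _ _ h₁, ENNReal.mul_rpow_of_nonneg _ _ h₂,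
      ENNReal.mul_rpow_of_nonneg _ _ h₃, ENNReal.mul_rpow_of_nonneg _ _ h₄,
      ENNReal.mul_rpow_of_nonneg _ _ h₅, ENNReal.mul_rpow_of_nonneg _ _ h₆]
    rw [ENNReal.rpow_add_of_nonneg _ _ (by positivity) h₃, ENNReal.rpow_add_of_nonneg _ _ h₁ h₂,
      ENNReal.rpow_add_of_nonneg _ _ (by positivity) h₅, ENNReal.rpow_add_of_nonneg _ _ h₁ h₄,
      ENNReal.rpow_add_of_nonneg _ _ (by positivity) h₆, ENNReal.rpow_add_of_nonneg _ _ h₂ h₄,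
      ENNReal.rpow_add_of_nonneg _ _ (by positivity) h₆, ENNReal.rpow_add_of_nonneg _ _ h₃ h₅]
    ring
  simp only [split]
  -- The six weights sum to 1, since each is counted twice in the total 2.
  have key := ENNReal.lintegral_prod_norm_pow_le (μ := μ) (Finset.univ : Finset (Fin 6))
    (f := ![fun z => u z * v z, fun z => u z * w z, fun z => u z * y z, fun z => v z * w z,
      fun z => v z * y z, fun z => w z * y z]) (p := ![ab, ac, ad, bc, bd, cd])
    (by intro i _; fin_cases i <;> simp <;> fun_prop)
    (by simp [Fin.sum_univ_six]; linarith)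
    (by intro i _; fin_cases i <;> simpa)
  simp only [Fin.prod_univ_six, Matrix.cons_val] at key
  refine key.trans ?_
  gcongr

/-- An `Lᵖ` function is dominated by a power of an integrable function, with matching norms. -/
theorem exists_ae_le_mul_rpow {α : Type*} [MeasurableSpace α] {μ : Measure α}
    {f : α → ℝ≥0∞} (hf : Measurable f) {p : ℝ≥0∞} (hp : p ≠ 0) :
    ∃ (F : α → ℝ≥0∞) (N : ℝ≥0∞), Measurable F ∧ (∀ᵐ x ∂μ, f x ≤ N * F x ^ (1 / p).toReal) ∧
      N * (∫⁻ x, F x ∂μ) ^ (1 / p).toReal = eLpNorm f p μ := by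
  by_cases hp' : p = ∞
  · subst hp'
    -- The exponent is 0 here and 0 ^ 0 = 1, so `N` carries the whole norm.
    refine ⟨0, eLpNorm f ∞ μ, measurable_zero, ?_, by simp⟩
    simpa using enorm_ae_le_eLpNormEssSup f μ
  · refine ⟨fun x => f x ^ p.toReal, 1, hf.pow_const _, ?_, ?_⟩
    · have : p.toReal ≠ 0 := (ENNReal.toReal_pos hp hp').ne'
      refine .of_forall fun x => ?_
      rw [one_mul, ← ENNReal.rpow_mul]
      simp [this]
    · rw [eLpNorm_eq_lintegral_rpow_enorm_toReal hp hp']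
      simp

/-! ### Pairwise integrals over the plane. -/

theorem lintegral_comp_snd_mul_comp_sub {F G : ℝ → ℝ≥0∞} (hF : Measurable F) (hG : Measurable G) :
    ∫⁻ z : ℝ × ℝ, F z.2 * G (z.1 - z.2) = (∫⁻ x, F x) * ∫⁻ x, G x := by
  rw [Measure.volume_eq_prod, lintegral_prod_symm' _ (by fun_prop)]
  have (t : ℝ) : ∫⁻ x, F t * G (x - t) = F t * ∫⁻ x, G x := by
    rw [lintegral_const_mul _ (by fun_prop), lintegral_sub_right_eq_self]
  simp_rw [this, lintegral_mul_const _ hF]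

theorem lintegral_comp_snd_mul_comp_add {F G : ℝ → ℝ≥0∞} (hF : Measurable F) (hG : Measurable G) :
    ∫⁻ z : ℝ × ℝ, F z.2 * G (z.1 + z.2) = (∫⁻ x, F x) * ∫⁻ x, G x := by
  rw [Measure.volume_eq_prod, lintegral_prod_symm' _ (by fun_prop)]
  have (t : ℝ) : ∫⁻ x, F t * G (x + t) = F t * ∫⁻ x, G x := by
    rw [lintegral_const_mul _ (by fun_prop), lintegral_add_right_eq_self]
  simp_rw [this, lintegral_mul_const _ hF]

theorem lintegral_comp_snd_mul_comp_fst {F G : ℝ → ℝ≥0∞} (hF : Measurable F) (hG : Measurable G) :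
    ∫⁻ z : ℝ × ℝ, F z.2 * G z.1 = (∫⁻ x, F x) * ∫⁻ x, G x := by
  rw [Measure.volume_eq_prod, lintegral_prod_symm' _ (by fun_prop)]
  simp_rw [lintegral_const_mul _ hG, lintegral_mul_const _ hF]

theorem lintegral_comp_sub_mul_comp_fst {F G : ℝ → ℝ≥0∞} (hF : Measurable F) (hG : Measurable G) :
    ∫⁻ z : ℝ × ℝ, F (z.1 - z.2) * G z.1 = (∫⁻ x, F x) * ∫⁻ x, G x := by
  rw [Measure.volume_eq_prod, lintegral_prod _ (by fun_prop)]
  have (x : ℝ) : ∫⁻ t, F (x - t) * G x = (∫⁻ x, F x) * G x := by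
    rw [lintegral_mul_const _ (by fun_prop), lintegral_sub_left_eq_self]
  simp_rw [this, lintegral_const_mul _ hG]

theorem lintegral_comp_add_mul_comp_fst {F G : ℝ → ℝ≥0∞} (hF : Measurable F) (hG : Measurable G) :
    ∫⁻ z : ℝ × ℝ, F (z.1 + z.2) * G z.1 = (∫⁻ x, F x) * ∫⁻ x, G x := by
  rw [Measure.volume_eq_prod, lintegral_prod _ (by fun_prop)]
  have (x : ℝ) : ∫⁻ t, F (x + t) * G x = (∫⁻ x, F x) * G x := by
    rw [lintegral_mul_const _ (by fun_prop), lintegral_add_left_eq_self]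
  simp_rw [this, lintegral_const_mul _ hG]

theorem lintegral_comp_two_mul_sub_le {G : ℝ → ℝ≥0∞} (hG : Measurable G) (u : ℝ) :
    ∫⁻ x, G (2 * x - u) ≤ ∫⁻ x, G x := by
  have h := lintegral_map (μ := volume) (hG.comp (measurable_id.sub_const u))
    (measurable_const_mul (2 : ℝ))
  rw [Real.map_volume_mul_left two_ne_zero, lintegral_smul_measure] at h
  simp only [Function.comp_apply, id] at h
  rw [← h, lintegral_sub_right_eq_self]
  refine mul_le_of_le_one_left zero_le ?_
  rw [ENNReal.ofReal_le_one, abs_of_pos] <;> norm_num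

/-- The map (x,t) ↦ (x-t, x+t) has Jacobian 2, so the true value is half the bound; the other pairs
have Jacobian ±1. -/
theorem lintegral_comp_sub_mul_comp_add_le {F G : ℝ → ℝ≥0∞} (hF : Measurable F)
    (hG : Measurable G) :
    ∫⁻ z : ℝ × ℝ, F (z.1 - z.2) * G (z.1 + z.2) ≤ (∫⁻ x, F x) * ∫⁻ x, G x := by
  rw [Measure.volume_eq_prod, lintegral_prod _ (by fun_prop)]
  have (x : ℝ) : ∫⁻ t, F (x - t) * G (x + t) = ∫⁻ u, F u * G (2 * x - u) := by
    rw [← lintegral_sub_left_eq_self _ x]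
    refine lintegral_congr fun u => ?_
    ring_nf
  simp_rw [this]
  rw [lintegral_lintegral_swap (by fun_prop), ← lintegral_mul_const _ hF]
  refine lintegral_mono fun u => ?_
  rw [lintegral_const_mul _ (by fun_prop)]
  exact mul_le_mul_right (lintegral_comp_two_mul_sub_le hG u) _

/-- Pulls null sets of the line back to null sets of the plane, so that a.e. bounds on one factor
survive composition. -/
theorem quasiMeasurePreserving_fst_sub_snd :
    Measure.QuasiMeasurePreserving (fun z : ℝ × ℝ => z.1 - z.2) := by
  have h := Measure.quasiMeasurePreserving_fst (μ := (volume : Measure ℝ))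
    (ν := (volume : Measure ℝ))
  exact h.comp (measurePreserving_sub_prod volume volume).quasiMeasurePreserving

theorem quasiMeasurePreserving_fst_add_snd :
    Measure.QuasiMeasurePreserving (fun z : ℝ × ℝ => z.1 + z.2) := by
  have h := Measure.quasiMeasurePreserving_snd (μ := (volume : Measure ℝ))
    (ν := (volume : Measure ℝ))
  exact h.comp (measurePreserving_prod_add volume volume).quasiMeasurePreserving

theorem toReal_one_div_le_one {p : ℝ≥0∞} (hp : 1 ≤ p) : (1 / p).toReal ≤ 1 := by
  refine ENNReal.toReal_le_of_le_ofReal zero_le_one ?_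
  simpa using hp

/-- The Brascamp–Lieb inequality for the four linear forms `t`, `x - t`, `x + t`, `x` on `ℝ²`. -/
theorem lintegral_quadrilinear_le {k f g h : ℝ → ℝ≥0∞} (hk : Measurable k) (hf : Measurable f)
    (hg : Measurable g) (hh : Measurable h) {q p₁ p₂ r : ℝ≥0∞} (hq : 1 ≤ q) (hp₁ : 1 ≤ p₁)
    (hp₂ : 1 ≤ p₂) (hr : 1 ≤ r) (hsum : 1 / q + 1 / p₁ + 1 / p₂ + 1 / r = 2) :
    ∫⁻ z : ℝ × ℝ, k z.2 * f (z.1 - z.2) * g (z.1 + z.2) * h z.1 ≤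
      eLpNorm k q volume * eLpNorm f p₁ volume * eLpNorm g p₂ volume * eLpNorm h r volume := by
  have ne0 {p : ℝ≥0∞} (hp : 1 ≤ p) : p ≠ 0 := (zero_lt_one.trans_le hp).ne'
  have fin {p : ℝ≥0∞} (hp : 1 ≤ p) : 1 / p ≠ ∞ := by simpa using ne0 hp
  obtain ⟨k', Nk, mk, hk', ek⟩ := exists_ae_le_mul_rpow (μ := volume) hk (ne0 hq)
  obtain ⟨f', Nf, mf, hf', ef⟩ := exists_ae_le_mul_rpow (μ := volume) hf (ne0 hp₁)
  obtain ⟨g', Ng, mg, hg', eg⟩ := exists_ae_le_mul_rpow (μ := volume) hg (ne0 hp₂)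
  obtain ⟨h', Nh, mh, hh', eh⟩ := exists_ae_le_mul_rpow (μ := volume) hh (ne0 hr)
  have hsum' : (1 / q).toReal + (1 / p₁).toReal + (1 / p₂).toReal + (1 / r).toReal = 2 := by
    have := congrArg ENNReal.toReal hsum
    rwa [ENNReal.toReal_add (by simp [*]) (fin hr),
      ENNReal.toReal_add (by simp [*]) (fin hp₂), ENNReal.toReal_add (fin hq) (fin hp₁),
      ENNReal.toReal_ofNat] at this
  have main := lintegral_rpow_mul_four_le (μ := (volume : Measure (ℝ × ℝ)))
    (u := fun z => k' z.2) (v := fun z => f' (z.1 - z.2)) (w := fun z => g' (z.1 + z.2))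
    (y := fun z => h' z.1) (by fun_prop) (by fun_prop) (by fun_prop) (by fun_prop)
    (lintegral_comp_snd_mul_comp_sub mk mf).le (lintegral_comp_snd_mul_comp_add mk mg).le
    (lintegral_comp_snd_mul_comp_fst mk mh).le (lintegral_comp_sub_mul_comp_add_le mf mg)
    (lintegral_comp_sub_mul_comp_fst mf mh).le (lintegral_comp_add_mul_comp_fst mg mh).le
    ENNReal.toReal_nonneg ENNReal.toReal_nonneg ENNReal.toReal_nonneg ENNReal.toReal_nonneg
    (toReal_one_div_le_one hq) (toReal_one_div_le_one hp₁) (toReal_one_div_le_one hp₂)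
    (toReal_one_div_le_one hr) hsum'
  rw [← ek, ← ef, ← eg, ← eh]
  have hpt : ∀ᵐ z : ℝ × ℝ, k z.2 * f (z.1 - z.2) * g (z.1 + z.2) * h z.1 ≤
      Nk * Nf * Ng * Nh * (k' z.2 ^ (1 / q).toReal * f' (z.1 - z.2) ^ (1 / p₁).toReal *
        g' (z.1 + z.2) ^ (1 / p₂).toReal * h' z.1 ^ (1 / r).toReal) := by
    filter_upwards [Measure.quasiMeasurePreserving_snd.ae hk',
      quasiMeasurePreserving_fst_sub_snd.ae hf', quasiMeasurePreserving_fst_add_snd.ae hg',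
      Measure.quasiMeasurePreserving_fst.ae hh'] with z h₁ h₂ h₃ h₄
    refine (mul_le_mul' (mul_le_mul' (mul_le_mul' h₁ h₂) h₃) h₄).trans_eq ?_
    ring
  refine (lintegral_mono_ae hpt).trans ?_
  rw [lintegral_const_mul _ (by fun_prop)]
  refine (mul_le_mul_right main _).trans_eq ?_
  ring

/-! ### Duality. -/

/-- The converse of Hölder's inequality for nonnegative functions. -/
theorem eLpNorm_le_of_forall_lintegral_mul_le {α : Type*} [MeasurableSpace α] {μ : Measure α}
    [SigmaFinite μ] {T : α → ℝ≥0∞} (hT : Measurable T) {p r : ℝ≥0∞} [hpr : p.HolderConjugate r]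
    {A : ℝ≥0∞} (h : ∀ φ : α → ℝ≥0∞, Measurable φ → ∫⁻ x, T x * φ x ∂μ ≤ A * eLpNorm φ r μ) :
    eLpNorm T p μ ≤ A := by
  by_cases hp : p = ∞
  · subst hp
    have hr : r = 1 := by simpa using hpr.inv_add_inv_eq_one
    subst hr
    rw [eLpNorm_exponent_top]
    refine eLpNormEssSup_le_of_ae_enorm_bound ?_
    refine ae_le_of_forall_setLIntegral_le_of_sigmaFinite hT fun s hs _ => ?_
    have := h (s.indicator 1) (measurable_one.indicator hs)
    rw [eLpNorm_one_eq_lintegral_enorm] at this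
    simp only [enorm_eq_self] at this
    rw [lintegral_indicator_one hs] at this
    rw [setLIntegral_const, ← lintegral_indicator hs]
    refine le_trans (lintegral_mono fun x => ?_) this
    by_cases hx : x ∈ s <;> simp [hx]
  by_cases hp1 : p = 1
  · subst hp1
    have hr : r = ∞ := by simpa using hpr.inv_add_inv_eq_one
    subst hr
    have := h 1 measurable_one
    rw [eLpNorm_one_eq_lintegral_enorm]
    refine (by simpa using this : _ ≤ A * eLpNorm (1 : α → ℝ≥0∞) ∞ μ).trans ?_
    refine mul_le_of_le_one_right zero_le ?_
    rw [eLpNorm_exponent_top]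
    exact eLpNormEssSup_le_of_ae_enorm_bound (.of_forall fun x => by simp)
  have hp0 : p ≠ 0 := ENNReal.HolderConjugate.ne_zero p r
  have hr0 : r ≠ 0 := ENNReal.HolderConjugate.ne_zero r p
  have hr : r ≠ ∞ := by
    rintro rfl
    exact hp1 (by simpa using hpr.inv_add_inv_eq_one)
  have hPR : p.toReal.HolderConjugate r.toReal :=
    ENNReal.HolderConjugate.toReal_of_ne_top hp hr
  set P := p.toReal
  set R := r.toReal
  have hPpos : 0 < P := hPR.pos
  have hRpos : 0 < R := hPR.symm.pos
  -- Truncating height and support makes ∫ Tn ^ P finite, which permits the division by I ^ (1 / R)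
  -- below.
  let Tn : ℕ → α → ℝ≥0∞ := fun n => (spanningSets μ n).indicator fun x => min (T x) n
  have hTn (n) : Measurable (Tn n) :=
    (hT.min measurable_const).indicator (measurableSet_spanningSets μ n)
  have hTn_le (n x) : Tn n x ≤ T x :=
    (Set.indicator_le_self _ _ x).trans (min_le_left _ _)
  have hI_top (n) : ∫⁻ x, Tn n x ^ P ∂μ ≠ ∞ := by
    have : ∫⁻ x, Tn n x ^ P ∂μ ≤ ∫⁻ x in spanningSets μ n, (n : ℝ≥0∞) ^ P ∂μ := by
      rw [← lintegral_indicator (measurableSet_spanningSets μ n)]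
      refine lintegral_mono fun x => ?_
      by_cases hx : x ∈ spanningSets μ n
      · simp only [Tn, hx, Set.indicator_of_mem]
        exact ENNReal.rpow_le_rpow (min_le_right _ _) hPpos.le
      · simp [Tn, hx, hPpos]
    refine ne_top_of_le_ne_top ?_ this
    rw [setLIntegral_const]
    exact ENNReal.mul_ne_top (ENNReal.rpow_ne_top_of_nonneg hPpos.le (by simp))
      (measure_spanningSets_lt_top μ n).ne
  have hI_le (n) : ∫⁻ x, Tn n x ^ P ∂μ ≤ A ^ P := by
    set I := ∫⁻ x, Tn n x ^ P ∂μ with hI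
    have h₁ : I ≤ A * I ^ (1 / R) := by
      -- The extremal function for Hölder's inequality.
      have := h (fun x => Tn n x ^ (P - 1)) ((hTn n).pow_const _)
      rw [eLpNorm_eq_lintegral_rpow_enorm_toReal hr0 hr] at this
      simp only [enorm_eq_self, ← ENNReal.rpow_mul] at this
      rw [show (P - 1) * r.toReal = P from hPR.sub_one_mul_conj] at this
      refine le_trans (lintegral_mono fun x => ?_) this
      calc Tn n x ^ P = Tn n x ^ (1 + (P - 1)) := by ring_nf
        _ = Tn n x * Tn n x ^ (P - 1) := by
          rw [ENNReal.rpow_add_of_nonneg _ _ zero_le_one hPR.sub_one_pos.le, ENNReal.rpow_one]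
        _ ≤ _ := mul_le_mul_left (hTn_le n x) _
    by_cases hI0 : I = 0
    · simp [hI0]
    have h₂ : I = I ^ (1 / P) * I ^ (1 / R) := by
      rw [← ENNReal.rpow_add _ _ hI0 (hI_top n), one_div, one_div, hPR.inv_add_inv_eq_one,
        ENNReal.rpow_one]
    have h₃ : I ^ (1 / P) ≤ A := by
      refine (ENNReal.mul_le_mul_iff_left ?_ ?_).1 (h₂.symm.trans_le h₁)
      · simp [hI0, hRpos, hRpos.le]
      · exact ENNReal.rpow_ne_top_of_nonneg (by positivity) (hI_top n)
    rwa [one_div, ENNReal.rpow_inv_le_iff hPpos] at h₃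
  have hlim : ∫⁻ x, T x ^ P ∂μ ≤ A ^ P := by
    refine le_of_tendsto' (lintegral_tendsto_of_tendsto_of_monotone
      (f := fun n x => Tn n x ^ P) (fun n => ((hTn n).pow_const P).aemeasurable)
      (.of_forall fun x m n hmn => ?_) (.of_forall fun x => ?_)) hI_le
    · refine ENNReal.rpow_le_rpow ?_ hPpos.le
      by_cases hx : x ∈ spanningSets μ m
      · simp only [Tn, hx, monotone_spanningSets μ hmn hx, Set.indicator_of_mem]
        gcongr
      · simp [Tn, hx]
    · refine ((ENNReal.continuous_rpow_const).tendsto _).comp ?_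
      have : Filter.Tendsto (fun n : ℕ => min (T x) (n : ℝ≥0∞)) Filter.atTop (nhds (T x)) := by
        simpa using (tendsto_const_nhds (x := T x)).min ENNReal.tendsto_nat_nhds_top
      refine this.congr' ?_
      filter_upwards [eventually_mem_spanningSets μ x] with n hn
      simp [Tn, hn]
  rw [eLpNorm_eq_lintegral_rpow_enorm_toReal hp0 hp, one_div, ENNReal.rpow_inv_le_iff hPpos]
  simpa using hlim

/-! ### Kernel representation. -/

/-- The Schwartz function `t ↦ f (x - t) g (x + t)`. -/
theorem exists_schwartzMap_sub_mul_add (f g : 𝓢(ℝ, ℂ)) (x : ℝ) :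
    ∃ G : 𝓢(ℝ, ℂ), ∀ t, G t = f (x - t) * g (x + t) := by
  refine ⟨SchwartzMap.pairing (ContinuousLinearMap.mul ℂ ℂ)
    (SchwartzMap.compCLMOfAntilipschitz ℂ (g := fun t : ℝ => x - t) (K := 1) (by fun_prop)
      (fun _ _ => by simp [edist_dist, dist_eq_norm, abs_sub_comm]) f)
    (SchwartzMap.compCLMOfAntilipschitz ℂ (g := fun t : ℝ => x + t) (K := 1) (by fun_prop)
      (fun _ _ => by simp [edist_dist, dist_eq_norm]) g), fun t => ?_⟩
  rfl

theorem continuous_fourier_schwartzMap (f : 𝓢(ℝ, ℂ)) : Continuous (𝓕 (f : ℝ → ℂ)) := by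
  rw [← SchwartzMap.fourier_coe]; exact (𝓕 f).continuous

theorem integrable_fourier_schwartzMap (f : 𝓢(ℝ, ℂ)) : Integrable (𝓕 (f : ℝ → ℂ)) := by
  rw [← SchwartzMap.fourier_coe]; exact (𝓕 f).integrable

theorem exists_norm_fourier_schwartzMap_le (f : 𝓢(ℝ, ℂ)) : ∃ c, ∀ ξ, ‖𝓕 (f : ℝ → ℂ) ξ‖ ≤ c := by
  rw [← SchwartzMap.fourier_coe]
  exact ⟨_, (𝓕 f).toBoundedContinuousFunction.norm_coe_le_norm⟩

/-- Fourier inversion for a product: the inverse transform of `t ↦ f (x - t) g (x + t)` is a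
modulated correlation of `f̂` and `ĝ`. -/
theorem fourierInv_sub_mul_add (f g : 𝓢(ℝ, ℂ)) (x ζ : ℝ) :
    𝓕⁻ (fun t => f (x - t) * g (x + t)) ζ =
      ∫ η : ℝ, 𝓕 (f : ℝ → ℂ) (ζ + η) * 𝓕 (g : ℝ → ℂ) η *
        Complex.exp (2 * Real.pi * Complex.I * ((ζ + η : ℝ) + η) * x) := by
  -- Both sides are iterated integrals of `H`: inverting f̂ gives the left side, and after Fubini
  -- the shifts ξ = ζ + η, v = x + t give the right.
  let H : ℝ → ℝ → ℂ := fun t ξ =>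
    Complex.exp ((2 * Real.pi * (t * ζ + ξ * (x - t)) : ℝ) * Complex.I) *
      (g (x + t) * 𝓕 (f : ℝ → ℂ) ξ)
  have hf (y : ℝ) : f y =
      ∫ ξ : ℝ, Complex.exp ((2 * Real.pi * (ξ * y) : ℝ) * Complex.I) * 𝓕 (f : ℝ → ℂ) ξ := by
    have h := congrFun (f.continuous.fourierInv_fourier_eq f.integrable
      (integrable_fourier_schwartzMap f)) y
    rw [← h, Real.fourierInv_eq']
    simp [mul_comm]
  have hg (η : ℝ) : 𝓕 (g : ℝ → ℂ) η =
      ∫ v : ℝ, Complex.exp ((-2 * Real.pi * v * η : ℝ) * Complex.I) * g v := by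
    rw [Real.fourier_real_eq_integral_exp_smul]; rfl
  have hH : Integrable (Function.uncurry H) (volume.prod volume) := by
    have h₁ : Integrable (fun t => g (x + t)) := g.integrable.comp_add_left x
    refine (h₁.mul_prod (integrable_fourier_schwartzMap f)).bdd_mul (c := 1) ?_ ?_
    · exact Continuous.aestronglyMeasurable (by fun_prop)
    · exact .of_forall fun z => (Complex.norm_exp_ofReal_mul_I _).le
  have hleft : 𝓕⁻ (fun t => f (x - t) * g (x + t)) ζ = ∫ t, ∫ ξ, H t ξ := by
    rw [Real.fourierInv_eq']
    refine integral_congr_ae (.of_forall fun t => ?_)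
    dsimp only
    rw [hf (x - t), smul_eq_mul, mul_comm (∫ _, _), ← integral_const_mul, ← integral_const_mul]
    refine integral_congr_ae (.of_forall fun ξ => ?_)
    simp only [H, RCLike.inner_apply, conj_trivial]
    rw [show (2 * Real.pi * (t * ζ + ξ * (x - t)) : ℝ) * Complex.I =
      (2 * Real.pi * (ζ * t) : ℝ) * Complex.I + (2 * Real.pi * (ξ * (x - t)) : ℝ) * Complex.I by
        push_cast; ring, Complex.exp_add]
    ring
  rw [hleft, integral_integral_swap hH, ← integral_add_left_eq_self _ ζ]
  refine integral_congr_ae (.of_forall fun η => ?_)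
  dsimp only
  rw [hg η, ← integral_add_left_eq_self (fun v : ℝ => _ * g v) x, mul_assoc, ← integral_mul_const,
    ← integral_const_mul]
  refine integral_congr_ae (.of_forall fun t => ?_)
  simp only [H]
  have hexp : Complex.exp ((2 * Real.pi * (t * ζ + (ζ + η) * (x - t)) : ℝ) * Complex.I) =
      Complex.exp ((-2 * Real.pi * (x + t) * η : ℝ) * Complex.I) *
        Complex.exp (2 * Real.pi * Complex.I * ((ζ + η : ℝ) + η) * x) := by
    rw [← Complex.exp_add]
    push_cast
    ring_nf
  rw [hexp]
  ring

theorem integrable_comp_sub {Φ : ℝ × ℝ → ℂ} (h : Integrable Φ) :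
    Integrable fun z : ℝ × ℝ => Φ (z.1 - z.2, z.2) :=
  (measurePreserving_sub_prod volume volume).integrable_comp_of_integrable h

theorem integral_comp_sub {Φ : ℝ × ℝ → ℂ} (h : Integrable Φ) :
    ∫ z : ℝ × ℝ, Φ (z.1 - z.2, z.2) = ∫ z, Φ z := by
  have hm := measurePreserving_sub_prod (volume : Measure ℝ) (volume : Measure ℝ)
  have := integral_map (μ := volume) hm.measurable.aemeasurable (f := Φ)
    (by rw [Measure.volume_eq_prod, hm.map_eq]; exact h.aestronglyMeasurable)
  rw [← this, Measure.volume_eq_prod, hm.map_eq]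

theorem locallyIntegrable_diffSymbol {M : ℝ → ℂ} (hM : Integrable M) :
    LocallyIntegrable (diffSymbol M) := by
  rw [locallyIntegrable_iff]
  intro s hs
  obtain ⟨r, hr⟩ := hs.isBounded.subset_closedBall 0
  let S := Metric.closedBall (0 : ℝ) r
  have h : Integrable (S.indicator fun _ => (1 : ℂ)) :=
    (integrable_indicator_iff measurableSet_closedBall).2
      (integrableOn_const (measure_closedBall_lt_top.ne))
  -- A cutoff in η alone suffices: after the shear the integrand is a tensor product of L¹
  -- functions.
  have hprod := integrable_comp_sub (Φ := fun z => M z.1 * S.indicator (fun _ => (1 : ℂ)) z.2)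
    (hM.mul_prod h)
  refine (hprod.integrableOn (s := s)).congr_fun_ae ?_
  filter_upwards [ae_restrict_mem hs.measurableSet] with z hz
  have : z.2 ∈ S := by
    have := hr hz
    simp only [Metric.mem_closedBall, dist_zero_right, S] at this ⊢
    exact (norm_snd_le z).trans this
  simp [diffSymbol, this]

theorem bilinearOp_diffSymbol_eq_integral {M : ℝ → ℂ} (hM : Integrable M) (f g : 𝓢(ℝ, ℂ)) (x : ℝ) :
    bilinearOp (diffSymbol M) f g x = ∫ ζ, 𝓕⁻ (fun t => f (x - t) * g (x + t)) ζ * M ζ := by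
  obtain ⟨c, hc⟩ := exists_norm_fourier_schwartzMap_le f
  have cf := continuous_fourier_schwartzMap f
  let Φ : ℝ × ℝ → ℂ := fun z => (𝓕 (f : ℝ → ℂ) (z.1 + z.2) *
    Complex.exp (2 * Real.pi * Complex.I * ((z.1 + z.2 : ℝ) + z.2) * x)) *
      (M z.1 * 𝓕 (g : ℝ → ℂ) z.2)
  have hΦ : Integrable Φ := by
    refine (hM.mul_prod (integrable_fourier_schwartzMap g)).bdd_mul (c := c) ?_ ?_
    · exact Continuous.aestronglyMeasurable (by fun_prop)
    · refine .of_forall fun z => ?_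
      rw [norm_mul, show 2 * Real.pi * Complex.I * ((z.1 + z.2 : ℝ) + z.2) * x =
        (2 * Real.pi * (z.1 + z.2 + z.2) * x : ℝ) * Complex.I by push_cast; ring,
        Complex.norm_exp_ofReal_mul_I, mul_one]
      exact hc _
  have h₁ : bilinearOp (diffSymbol M) f g x = ∫ z : ℝ × ℝ, Φ (z.1 - z.2, z.2) := by
    refine integral_congr_ae (.of_forall fun z => ?_)
    simp only [Φ, diffSymbol, sub_add_cancel]
    ring
  rw [h₁, integral_comp_sub hΦ, Measure.volume_eq_prod, integral_prod _ hΦ]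
  congr! 2 with ζ
  rw [fourierInv_sub_mul_add, ← integral_mul_const]
  congr! 2 with η
  simp only [Φ]
  ring

/-- The bilinear operator with symbol `K̂ (ξ - η)` has the kernel representation
`∫ K(t) f(x - t) g(x + t) dt`. -/
theorem bilinearOp_diffSymbol_eq_kernel {q : ℝ≥0∞} [Fact (1 ≤ q)] {M K : ℝ → ℂ}
    (hM : MemLp M 1 volume) (hK : MemLp K q volume)
    (hMK : 𝓕 (hK.toLp K : 𝓢'(ℝ, ℂ)) = (hM.toLp M : 𝓢'(ℝ, ℂ))) (f g : 𝓢(ℝ, ℂ)) (x : ℝ) :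
    bilinearOp (diffSymbol M) f g x = ∫ t, f (x - t) * g (x + t) * K t := by
  obtain ⟨G, hG⟩ := exists_schwartzMap_sub_mul_add f g x
  -- Testing K̂ = M on the inverse transform of `G` moves the Fourier transform off K.
  have h := congrArg (fun T : 𝓢'(ℝ, ℂ) => T (𝓕⁻ G)) hMK
  simp only [TemperedDistribution.fourier_apply, FourierTransform.fourier_fourierInv_eq,
    Lp.toTemperedDistribution_apply] at h
  rw [bilinearOp_diffSymbol_eq_integral (memLp_one_iff_integrable.1 hM)]
  have hG' : (fun t => f (x - t) * g (x + t)) = G := funext fun t => (hG t).symm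
  rw [hG', ← SchwartzMap.fourierInv_coe]
  calc ∫ ζ, (𝓕⁻ G) ζ * M ζ = ∫ ζ, (𝓕⁻ G) ζ • hM.toLp M ζ := by
        refine integral_congr_ae ?_
        filter_upwards [hM.coeFn_toLp] with ζ h
        rw [h, smul_eq_mul]
    _ = ∫ t, G t • hK.toLp K t := h.symm
    _ = ∫ t, f (x - t) * g (x + t) * K t := by
        refine integral_congr_ae ?_
        filter_upwards [hK.coeFn_toLp] with t h
        rw [h, hG, smul_eq_mul]

/-! ### The multiplier bound. -/

theorem bilinearBound_diffSymbol {q p₁ p₂ p₃ : ℝ≥0∞} [hq1 : Fact (1 ≤ q)] {M K : ℝ → ℂ}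
    (hM : MemLp M 1 volume) (hK : MemLp K q volume)
    (hMK : 𝓕 (hK.toLp K : 𝓢'(ℝ, ℂ)) = (hM.toLp M : 𝓢'(ℝ, ℂ)))
    (hp₁ : 1 ≤ p₁) (hp₂ : 1 ≤ p₂) (hp₃ : 1 ≤ p₃)
    (hsum : 1 / q + 1 / p₁ + 1 / p₂ = 1 + 1 / p₃) :
    BilinearBound (diffSymbol M) p₁ p₂ p₃ (eLpNorm K q volume) := by
  intro f _ g _
  let k : ℝ → ℝ≥0∞ := fun t => ‖hK.1.mk K t‖ₑ
  have hk : Measurable k := hK.1.stronglyMeasurable_mk.measurable.enorm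
  have mf : Measurable fun t => ‖f t‖ₑ := f.continuous.measurable.enorm
  have mg : Measurable fun t => ‖g t‖ₑ := g.continuous.measurable.enorm
  let Ψ : ℝ × ℝ → ℝ≥0∞ := fun z => k z.2 * ‖f (z.1 - z.2)‖ₑ * ‖g (z.1 + z.2)‖ₑ
  have hΨ : Measurable Ψ :=
    ((hk.comp measurable_snd).mul (mf.comp (measurable_fst.sub measurable_snd))).mul
      (mg.comp (measurable_fst.add measurable_snd))
  have hpt (x : ℝ) : ‖bilinearOp (diffSymbol M) f g x‖ₑ ≤ ‖∫⁻ t, Ψ (x, t)‖ₑ := by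
    rw [bilinearOp_diffSymbol_eq_kernel hM hK hMK, enorm_eq_self]
    refine (enorm_integral_le_lintegral_enorm _).trans_eq (lintegral_congr_ae ?_)
    filter_upwards [hK.1.ae_eq_mk] with t ht
    simp only [Ψ, k, enorm_mul, ht]
    ring
  have hkK : eLpNorm k q volume = eLpNorm K q volume := by
    rw [eLpNorm_enorm]
    exact eLpNorm_congr_ae hK.1.ae_eq_mk.symm
  refine (eLpNorm_mono_enorm hpt).trans ?_
  have hconj := ENNReal.HolderConjugate.conjExponent hp₃
  refine eLpNorm_le_of_forall_lintegral_mul_le hΨ.lintegral_prod_right' (hpr := hconj)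
    fun φ hφ => ?_
  have hsum' : 1 / q + 1 / p₁ + 1 / p₂ + 1 / p₃.conjExponent = 2 := by
    have := hconj.inv_add_inv_eq_one
    rw [hsum, add_assoc, one_div, one_div, this, one_add_one_eq_two]
  have key := lintegral_quadrilinear_le hk mf mg hφ hq1.out hp₁ hp₂
    (ENNReal.HolderConjugate.one_le _ p₃) hsum'
  rw [hkK, eLpNorm_enorm, eLpNorm_enorm] at key
  refine le_trans (le_of_eq ?_) key
  rw [Measure.volume_eq_prod]
  refine .trans ?_ (lintegral_prod _ (hΨ.mul (hφ.comp measurable_fst)).aemeasurable).symm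
  refine lintegral_congr fun x => ?_
  exact (lintegral_mul_const _ (hΨ.comp measurable_prodMk_left)).symm

theorem mainTheorem2 (p₁ p₂ p₃ q : ℝ≥0∞) [Fact (1 ≤ q)]
    (hp₁ : 1 ≤ p₁) (hp₂ : 1 ≤ p₂) (hp₃ : 1 ≤ p₃)
    (hlower : 1 / p₃ ≤ 1 / p₁ + 1 / p₂)
    (hupper : 1 / p₁ + 1 / p₂ ≤ min 2 (1 / p₃ + 1))
    (hq : 1 / p₁ + 1 / p₂ - 1 / p₃ = 1 - 1 / q) :
    ∃ C : ℝ≥0, ∀ (M K : ℝ → ℂ) (hM : MemLp M 1 volume) (hK : MemLp K q volume),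
      𝓕 (hK.toLp K : 𝓢'(ℝ, ℂ)) = (hM.toLp M : 𝓢'(ℝ, ℂ)) →
        M ∈ OneVariableMultipliers p₁ p₂ p₃ ∧
        bilinearMultiplierNorm (diffSymbol M) p₁ p₂ p₃ ≤ C * eLpNorm K q volume := by
  have hq1 : 1 / q ≤ 1 := by simpa using Fact.out (p := 1 ≤ q)
  -- `hlower` and `hq1` make the truncated subtractions in `hq` genuine.
  have hsum : 1 / q + 1 / p₁ + 1 / p₂ = 1 + 1 / p₃ := by
    rw [add_assoc, ← tsub_add_cancel_of_le hlower, hq, ← add_assoc,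
      add_tsub_cancel_of_le hq1]
  -- No step loses a constant, so C = 1.
  refine ⟨1, fun M K hM hK hMK => ?_⟩
  have hB := bilinearBound_diffSymbol hM hK hMK hp₁ hp₂ hp₃ hsum
  refine ⟨⟨hM.1, locallyIntegrable_diffSymbol (memLp_one_iff_integrable.1 hM),
    (eLpNorm K q volume).toNNReal, ?_⟩, ?_⟩
  · rwa [ENNReal.coe_toNNReal hK.2.ne]
  · rw [ENNReal.coe_one, one_mul]
    exact sInf_le hB
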